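/- Let $1\le N_t\le T$, $N_t\le N_r$, $L\ge 2$ and $N$ be integers, and let $\boldsymbol\mu_1,\dots,\boldsymbol\mu_L\in\mathbb{C}^{T\times N_t}$ be codewords with orthonormal columns. For such matrices let $d_p(\boldsymbol\Upsilon,\boldsymbol\Upsilon')=\sqrt{N_t-\mathrm{tr}(\boldsymbol\Upsilon\boldsymbol\Upsilon^H\boldsymbol\Upsilon'\boldsymbol\Upsilon'^H)}$ be the Procrustes distance, put $d_{\min}=\min_{\ell\ne m}d_p(\boldsymbol\mu_\ell,\boldsymbol\mu_m)$, and let the DFS threshold satisfy $0\le\gamma_0<d_{\min}$. Let $\bar\lambda$ be the expectation of a typical singular value of an $N_t\times N_r$ matrix $\mathbf H$ with i.i.d. $\mathcal{CN}(0,1)$ entries, i.e. $\bar\lambda=\mathbb{E}\big[\frac1{N_t}\sum_{k=1}^{N_t}\lambda_k(\mathbf H)\big]$. A block of $N$ symbols $\mathbf X^{(i)}=\boldsymbol\mu_{s_i}$ is transmitted, where $(s_1,\dots,s_N)\in\{1,\dots,L\}^N$ has an arbitrary (possibly deterministic) law. Under the isotropic-noise approximation, at signal-to-noise ratio $\rho$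 the received Grassmann symbols are $$\boldsymbol\Upsilon^{(i)}=\mathsf{span}\Big(\mathbf X^{(i)}+\frac1{\bar\lambda}\sqrt{\frac{N_t}{\rho T}}\,\mathbf W^{(i)}\Big),$$ where $\mathsf{span}(\mathbf A)$ denotes an orthonormal basis of the column space of $\mathbf A$ and the $\mathbf W^{(i)}\in\mathbb{C}^{T\times N_t}$ are independent of each other and of $(s_i)$, with i.i.d. $\mathcal{CN}(0,1)$ entries. Let $\mathcal C_\ell=\{i: s_i=\ell\}$ be the clusters and $$p_{\mathsf{sep}}(\rho)=\Pr\Big(\min_{m\neq\ell}\ \min_{i\in\mathcal C_m,\,j\in\mathcal C_\ell}d_p(\boldsymbol\Upsilon^{(i)},\boldsymbol\Upsilon^{(j)})>\gamma_0\Big)$$ the DFS separability probability (a minimum over an empty set is $+\infty$). Put $D=2N_t(T-N_t)$, $\gamma(a,x)=\int_0^x t^{a-1}e^{-t}\,dt$ and $$c=\frac{T\bar\lambda^2(d_{\min}-\gamma_0)^2}{8N_t},\qquad C_m(\rho)=\sum_{m=0}^{D/2-1}\frac{(T\bar\lambda^2(d_{\min}-\gamma_0)^2)^m}{m!\,(8N_t)^m}\rho^m.$$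 Then, for all sufficiently large $\rho$, $$p_{\mathsf{sep}}(\rho)\ \ge\ \left[\frac1{\Gamma(D/2)}\,\gamma\Big(\frac D2,\frac{\rho T\bar\lambda^2(d_{\min}-\gamma_0)^2}{8N_t}\Big)\right]^N,$$ and, as $\rho\to\infty$, the right-hand side equals $$1-N\,e^{-\rho T\bar\lambda^2(d_{\min}-\gamma_0)^2/(8N_t)}\,C_m(\rho)+O\big(e^{-2c\rho}\,C_m(\rho)^2\big).$$ In particular the remainder is $O(e^{-2\rho})$ whenever $c>1$. -/

import Mathlib

open MeasureTheory ProbabilityTheory Filter Asymptotics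
open scoped Matrix Nat

noncomputable section

namespace GrassmannDFS

/-- The circularly symmetric complex Gaussian law `CN(0, 1)`: independent real and imaginary parts,
each a real Gaussian of mean `0` and variance `1 / 2`. -/
def complexGaussian : Measure ℂ :=
  ((gaussianReal 0 (1 / 2)).prod (gaussianReal 0 (1 / 2))).map Complex.measurableEquivRealProd.symm

/-- The law of an `m × n` array of i.i.d. `CN(0, 1)` entries. -/
def gaussianArray (m n : ℕ) : Measure (Fin m → Fin n → ℂ) :=
  Measure.pi fun _ => Measure.pi fun _ => complexGaussian

/-- The mean of a typical (uniformly chosen) singular value of an `Nt × Nr` channel matrix with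
i.i.d. `CN(0, 1)` entries, where `Nt ≤ Nr`. (Mathlib lists the singular values in descending order,
starting at index `0`; the average is over the first `Nt`. The integrand is nonnegative, and its
expectation is written as a lower Lebesgue integral.) -/
def meanSingularValue (Nt Nr : ℕ) : ℝ :=
  (∫⁻ H : Fin Nt → Fin Nr → ℂ,
    ENNReal.ofReal
      ((∑ k ∈ Finset.range Nt, (Matrix.toEuclideanLin (Matrix.of H)).singularValues k) / Nt)
    ∂(gaussianArray Nt Nr)).toReal

/-- `span(A)`: the matrix whose columns are the Gram-Schmidt orthonormalization of the columns of
`A`. For `A` of full column rank they form an orthonormal basis of the column space of `A`. (If the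
columns are linearly dependent, some columns of the result vanish.) -/
def spanBasis {T n : ℕ} (A : Matrix (Fin T) (Fin n) ℂ) : Matrix (Fin T) (Fin n) ℂ :=
  Matrix.of fun t k =>
    InnerProductSpace.gramSchmidtNormed ℂ
      (fun j : Fin n => (WithLp.toLp 2 fun s : Fin T => A s j : EuclideanSpace ℂ (Fin T))) k t

/-- The Procrustes distance `√(n - tr(Υ Υᴴ Υ' Υ'ᴴ))` between the points of the Grassmannian that are
represented by `Υ` and `Υ'`; the trace is a real number when `Υ`, `Υ'` have orthonormal columns. -/
def procrustesDist {T n : ℕ} (U V : Matrix (Fin T) (Fin n) ℂ) : ℝ :=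
  Real.sqrt (n - (U * Uᴴ * V * Vᴴ).trace.re)

/-- The minimum pairwise Procrustes distance of a codebook. -/
def minDist {T Nt L : ℕ} (μ : Fin L → Matrix (Fin T) (Fin Nt) ℂ) : ℝ :=
  ⨅ p : {p : Fin L × Fin L // p.1 ≠ p.2}, procrustesDist (μ p.1.1) (μ p.1.2)

/-- The received Grassmann symbol `span(X + (1 / lam) √(Nt / (ρ T)) W)` for a transmitted symbol
`X` and noise `W`, under the isotropic-noise approximation, at signal-to-noise ratio `ρ`. -/
def received {T Nt : ℕ} (lam ρ : ℝ) (X W : Matrix (Fin T) (Fin Nt) ℂ) :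
    Matrix (Fin T) (Fin Nt) ℂ :=
  spanBasis (X + ((1 / lam * Real.sqrt (Nt / (ρ * T)) : ℝ) : ℂ) • W)

/-- The cluster `C_ℓ`: the indices of the symbols that originate from codeword number `ℓ`, if the
`i`-th transmitted symbol is codeword number `s i`. -/
def cluster {N L : ℕ} (s : Fin N → Fin L) (l : Fin L) : Set (Fin N) := {i | s i = l}

/-- The inter-cluster distance: the minimum pairwise distance between the symbols of two clusters
(`⊤` if one of them is empty). -/
def clusterDist {T Nt N : ℕ} (Y : Fin N → Matrix (Fin T) (Fin Nt) ℂ) (C C' : Set (Fin N)) :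
    EReal :=
  ⨅ i ∈ C, ⨅ j ∈ C', (procrustesDist (Y i) (Y j) : EReal)

/-- The DFS separability probability: the probability that every two different clusters of the
`N` received symbols have inter-cluster distance larger than the threshold `γ₀`. The transmitted
indices have joint law `Q`; the noise matrices are i.i.d. with i.i.d. `CN(0, 1)` entries and
independent of the transmitted indices. -/
def sepProb {T Nt L N : ℕ} (μ : Fin L → Matrix (Fin T) (Fin Nt) ℂ)
    (Q : Measure (Fin N → Fin L)) (lam ρ γ₀ : ℝ) : ℝ :=
  (Q.prod (Measure.pi fun _ : Fin N => gaussianArray T Nt)).real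
    {ω : (Fin N → Fin L) × (Fin N → Fin T → Fin Nt → ℂ) |
      (γ₀ : EReal) < ⨅ m : Fin L, ⨅ l : Fin L, ⨅ _ : m ≠ l,
        clusterDist (fun i => received lam ρ (μ (ω.1 i)) (Matrix.of (ω.2 i)))
          (cluster ω.1 m) (cluster ω.1 l)}

/-- The real dimension `D = 2 Nt (T - Nt)` of the Grassmannian, for `Nt ≤ T`. -/
def grassDim (T Nt : ℕ) : ℕ := 2 * Nt * (T - Nt)

/-- The lower incomplete Gamma function `γ(s, x)`. -/
def lowerGamma (s x : ℝ) : ℝ := ∫ t in (0 : ℝ)..x, t ^ (s - 1) * Real.exp (-t)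

/-- The rate `T lam² δ² / (8 Nt)`. -/
def rate (T Nt : ℕ) (lam δ : ℝ) : ℝ := T * lam ^ 2 * δ ^ 2 / (8 * Nt)

/-- The polynomial `C(ρ) = ∑_{m < D / 2} (T lam² δ²)^m / (m! (8 Nt)^m) ρ^m`; `D` is even. -/
def polyC (T Nt : ℕ) (lam δ ρ : ℝ) : ℝ :=
  ∑ m ∈ Finset.range (grassDim T Nt / 2),
    (T * lam ^ 2 * δ ^ 2) ^ m / (m ! * (8 * Nt) ^ m) * ρ ^ m

/-- The lower bound `[γ(D/2, ρ T lam² δ² / (8 Nt)) / Γ(D/2)] ^ N`. -/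
def sepBound (T Nt N : ℕ) (lam δ ρ : ℝ) : ℝ :=
  (1 / Real.Gamma ((grassDim T Nt : ℝ) / 2) *
    lowerGamma ((grassDim T Nt : ℝ) / 2) (ρ * T * lam ^ 2 * δ ^ 2 / (8 * Nt))) ^ N

end GrassmannDFS

end

/-! Write `δ = minDist μ - γ₀`. Separation is forced by a deterministic event. For orthonormal
bases, `√2` times the Procrustes distance is the Frobenius distance of the projections; for spans
that lost rank it is still an upper bound. The triangle inequality then shows that noise of
Frobenius norm at most `r` on each symbol costs at most `2 r` of distance
(`procrustesDist_spanBasis_ge`). So if `2 r < δ`, the separability probability is at least the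
`N`-th power of the probability of one noise ball, whatever the law of the indices
(`pow_le_sepProb`).

For `r` near `δ / 2` the ball is about `‖W‖² < 2cρ`, and a Chernoff bound makes its complement
smaller than `exp (-cρ)` for large `ρ`. The claimed bound concedes a failure probability of at least
`exp (-cρ)` per symbol. This slack in the exponent makes the exact law of the noise norm irrelevant.

As `D / 2` is a positive integer, the normalized incomplete Gamma function is `1 - gammaTail`, and
the expansion is a second order Bernoulli estimate in that tail. -/

namespace GrassmannDFS

/-! ### Frobenius norms and orthogonal projections -/

section Frobenius

attribute [local instance] Matrix.frobeniusNormedAddCommGroup Matrix.frobeniusNormedSpace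

theorem frobenius_norm_sq_eq_sum {m n : Type*} [Fintype m] [Fintype n] (A : Matrix m n ℂ) :
    ‖A‖ ^ 2 = ∑ i, ∑ j, ‖A i j‖ ^ 2 := by
  have h : 0 ≤ ∑ i, ∑ j, ‖A i j‖ ^ 2 := by positivity
  rw [Matrix.frobenius_norm_def, ← Real.sqrt_eq_rpow]
  simp only [Real.rpow_two]
  exact Real.sq_sqrt h

theorem frobenius_norm_sq_eq_trace {m n : Type*} [Fintype m] [Fintype n] (A : Matrix m n ℂ) :
    ‖A‖ ^ 2 = (Aᴴ * A).trace.re := by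
  rw [frobenius_norm_sq_eq_sum, Finset.sum_comm]
  simp only [Matrix.trace, Matrix.diag_apply, Matrix.mul_apply, Matrix.conjTranspose_apply,
    Complex.re_sum]
  refine Finset.sum_congr rfl fun i _ => Finset.sum_congr rfl fun j _ => ?_
  rw [← Complex.normSq_eq_norm_sq, Complex.star_def, ← Complex.normSq_eq_conj_mul_self,
    Complex.ofReal_re]

/-- The squared distance of two orthogonal projections. -/
theorem frobenius_norm_sub_sq_of_projections {n : Type*} [Fintype n] {P Q : Matrix n n ℂ}
    (hP : Pᴴ = P) (hP2 : P * P = P) (hQ : Qᴴ = Q) (hQ2 : Q * Q = Q) :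
    ‖P - Q‖ ^ 2 = P.trace.re + Q.trace.re - 2 * (P * Q).trace.re := by
  rw [frobenius_norm_sq_eq_trace, Matrix.conjTranspose_sub, hP, hQ, Matrix.sub_mul,
    Matrix.mul_sub, Matrix.mul_sub, hP2, hQ2]
  simp only [Matrix.trace_sub, Complex.sub_re]
  rw [Matrix.trace_mul_comm Q P]
  ring

/-- An orthogonal projection does not increase the Frobenius norm. -/
theorem frobenius_norm_projection_mul_le {m n : Type*} [Fintype m] [Fintype n]
    {P : Matrix m m ℂ} (hP : Pᴴ = P) (hP2 : P * P = P) (M : Matrix m n ℂ) :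
    ‖M - P * M‖ ^ 2 = ‖M‖ ^ 2 - (Mᴴ * P * M).trace.re ∧ ‖M - P * M‖ ^ 2 ≤ ‖M‖ ^ 2 := by
  have h1 : ‖P * M‖ ^ 2 = (Mᴴ * P * M).trace.re := by
    rw [frobenius_norm_sq_eq_trace, Matrix.conjTranspose_mul, hP, Matrix.mul_assoc Mᴴ P,
      ← Matrix.mul_assoc P, hP2, Matrix.mul_assoc]
  have h2 : ‖M - P * M‖ ^ 2 = ‖M‖ ^ 2 - (Mᴴ * P * M).trace.re := by
    have e : (M - P * M)ᴴ * (M - P * M) = Mᴴ * M - Mᴴ * P * M := by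
      rw [Matrix.conjTranspose_sub, Matrix.conjTranspose_mul, hP, Matrix.sub_mul, Matrix.mul_sub,
        Matrix.mul_sub, Matrix.mul_assoc Mᴴ P (P * M), ← Matrix.mul_assoc P P, hP2,
        ← Matrix.mul_assoc, sub_self, sub_zero]
    rw [frobenius_norm_sq_eq_trace, frobenius_norm_sq_eq_trace, e, Matrix.trace_sub,
      Complex.sub_re]
  exact ⟨h2, by rw [h2, ← h1]; nlinarith [sq_nonneg ‖P * M‖]⟩

end Frobenius

/-! ### Gram-Schmidt bases, dependent columns included -/

section SpanBasis

variable {T n : ℕ} (A : Matrix (Fin T) (Fin n) ℂ)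

/-- Gram-Schmidt turns dependent columns into zero columns. This weak orthonormality suffices for
`spanProj` to be a projection, so full rank of the noisy symbols need never be proved. -/
theorem spanBasis_gram : ∃ d : Fin n → ℂ, (spanBasis A)ᴴ * spanBasis A = Matrix.diagonal d ∧
    ∀ k, (d k = 1 ∨ d k = 0 ∧ ∀ t, spanBasis A t k = 0) := by
  set f : Fin n → EuclideanSpace ℂ (Fin T) := fun j => WithLp.toLp 2 fun s => A s j with hf
  have hin : ∀ i j, ((spanBasis A)ᴴ * spanBasis A) i j =
      inner ℂ (InnerProductSpace.gramSchmidtNormed ℂ f i)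
        (InnerProductSpace.gramSchmidtNormed ℂ f j) := by
    intro i j
    simp [Matrix.mul_apply, spanBasis, PiLp.inner_apply, mul_comm, hf]
  refine ⟨fun k => ((spanBasis A)ᴴ * spanBasis A) k k, ?_, fun k => ?_⟩
  · ext i j
    by_cases hij : i = j
    · subst hij; simp
    · rw [Matrix.diagonal_apply_ne _ hij, hin]
      simp only [InnerProductSpace.gramSchmidtNormed, inner_smul_left, inner_smul_right,
        InnerProductSpace.gramSchmidt_orthogonal ℂ f hij, mul_zero]
  · by_cases h0 : InnerProductSpace.gramSchmidtNormed ℂ f k = 0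
    · right
      refine ⟨by simp [hin, h0], fun t => ?_⟩
      change InnerProductSpace.gramSchmidtNormed ℂ f k t = 0
      rw [h0]; rfl
    · left
      simp only [hin]
      rw [inner_self_eq_norm_sq_to_K, InnerProductSpace.gramSchmidtNormed_unit_length' h0]
      simp

theorem spanBasis_mul_gram : spanBasis A * ((spanBasis A)ᴴ * spanBasis A) = spanBasis A := by
  obtain ⟨d, hd, h⟩ := spanBasis_gram A
  rw [hd]
  ext t k
  rw [Matrix.mul_diagonal]
  rcases h k with h | ⟨-, h⟩
  · rw [h, mul_one]
  · rw [h, zero_mul]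

/-- The orthogonal projection onto the column space of `A`. -/
noncomputable def spanProj : Matrix (Fin T) (Fin T) ℂ := spanBasis A * (spanBasis A)ᴴ

theorem spanProj_conjTranspose : (spanProj A)ᴴ = spanProj A := by
  simp [spanProj, Matrix.conjTranspose_mul]

theorem spanProj_mul_self : spanProj A * spanProj A = spanProj A := by
  have := spanBasis_mul_gram A
  rw [spanProj, ← Matrix.mul_assoc, Matrix.mul_assoc (spanBasis A), this]

theorem spanProj_trace_le : (spanProj A).trace.re ≤ n := by
  obtain ⟨d, hd, h⟩ := spanBasis_gram A
  rw [spanProj, Matrix.trace_mul_comm, hd, Matrix.trace_diagonal, Complex.re_sum]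
  have : ∀ k ∈ Finset.univ, (d k).re ≤ (1 : ℝ) := by
    intro k _
    rcases h k with h | ⟨h, -⟩ <;> rw [h] <;> simp
  simpa using Finset.sum_le_sum this

theorem spanProj_mul : spanProj A * A = A := by
  set f : Fin n → EuclideanSpace ℂ (Fin T) := fun j => WithLp.toLp 2 fun s => A s j with hf
  have hspan : ∀ j, ∃ c : Fin n → ℂ,
      ∑ k, c k • InnerProductSpace.gramSchmidtNormed ℂ f k = f j := by
    intro j
    rw [← Submodule.mem_span_range_iff_exists_fun,
      InnerProductSpace.span_gramSchmidtNormed_range, InnerProductSpace.span_gramSchmidt]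
    exact Submodule.subset_span ⟨j, rfl⟩
  choose c hc using hspan
  have hA : A = spanBasis A * Matrix.of fun k j => c j k := by
    ext t j
    have := congrArg (fun v : EuclideanSpace ℂ (Fin T) => v t) (hc j)
    simp only [hf, WithLp.ofLp_sum, Finset.sum_apply, PiLp.smul_apply] at this
    rw [← this, Matrix.mul_apply]
    exact Finset.sum_congr rfl fun k _ => by simp [spanBasis, mul_comm]
  have hB : spanProj A * spanBasis A = spanBasis A := by
    rw [spanProj, Matrix.mul_assoc, spanBasis_mul_gram]
  calc spanProj A * A = spanProj A * (spanBasis A * Matrix.of fun k j => c j k) := by rw [← hA]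
    _ = A := by rw [← Matrix.mul_assoc, hB, ← hA]

end SpanBasis

/-! ### Perturbation of the Procrustes distance -/

section Procrustes

attribute [local instance] Matrix.frobeniusNormedAddCommGroup Matrix.frobeniusNormedSpace

variable {T n : ℕ}

theorem procrustesDist_eq (U V : Matrix (Fin T) (Fin n) ℂ) :
    procrustesDist U V = Real.sqrt (n - ((U * Uᴴ) * (V * Vᴴ)).trace.re) := by
  rw [procrustesDist, ← Matrix.mul_assoc]

theorem procrustesDist_comm (U V : Matrix (Fin T) (Fin n) ℂ) :
    procrustesDist U V = procrustesDist V U := by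
  rw [procrustesDist_eq, procrustesDist_eq, Matrix.trace_mul_comm]

theorem trace_re_of_orthonormal {X : Matrix (Fin T) (Fin n) ℂ} (hX : Xᴴ * X = 1) :
    (X * Xᴴ).trace.re = n := by
  rw [Matrix.trace_mul_comm, hX]; simp

theorem mul_self_of_orthonormal {X : Matrix (Fin T) (Fin n) ℂ} (hX : Xᴴ * X = 1) :
    (X * Xᴴ) * (X * Xᴴ) = X * Xᴴ := by
  rw [← Matrix.mul_assoc, Matrix.mul_assoc X, hX, Matrix.mul_one]

/-- The squared norm is `tr P + tr Q - 2 tr (P Q)`; a rank deficit only lowers the first two terms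
below `n`. -/
theorem norm_sub_le_procrustesDist {U V : Matrix (Fin T) (Fin n) ℂ}
    (hU : (U * Uᴴ) * (U * Uᴴ) = U * Uᴴ) (hV : (V * Vᴴ) * (V * Vᴴ) = V * Vᴴ)
    (hUn : (U * Uᴴ).trace.re ≤ n) (hVn : (V * Vᴴ).trace.re ≤ n) :
    ‖U * Uᴴ - V * Vᴴ‖ ≤ Real.sqrt 2 * procrustesDist U V := by
  rw [procrustesDist_eq, ← Real.sqrt_mul (by norm_num)]
  apply Real.le_sqrt_of_sq_le
  rw [frobenius_norm_sub_sq_of_projections (by simp) hU (by simp) hV]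
  linarith

theorem procrustesDist_eq_norm_sub {X Y : Matrix (Fin T) (Fin n) ℂ}
    (hX : Xᴴ * X = 1) (hY : Yᴴ * Y = 1) :
    Real.sqrt 2 * procrustesDist X Y = ‖X * Xᴴ - Y * Yᴴ‖ := by
  rw [procrustesDist_eq, ← Real.sqrt_mul (by norm_num), ← Real.sqrt_sq (norm_nonneg (_ - _)),
    frobenius_norm_sub_sq_of_projections (by simp) (mul_self_of_orthonormal hX) (by simp)
      (mul_self_of_orthonormal hY), trace_re_of_orthonormal hX, trace_re_of_orthonormal hY]
  congr 1; ring

/-- The Procrustes distance of the column spaces is at most the Frobenius distance. -/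
theorem procrustesDist_spanBasis_le {X : Matrix (Fin T) (Fin n) ℂ} (hX : Xᴴ * X = 1)
    (E : Matrix (Fin T) (Fin n) ℂ) {r : ℝ} (hr : 0 ≤ r)
    (h : ∑ i, ∑ j, ‖E i j‖ ^ 2 ≤ r ^ 2) :
    procrustesDist X (spanBasis (X + E)) ≤ r := by
  rw [procrustesDist_eq]
  apply Real.sqrt_le_iff.mpr ⟨hr, ?_⟩
  have hP := spanProj_conjTranspose (X + E)
  have hP2 := spanProj_mul_self (X + E)
  have hA := spanProj_mul (X + E)
  change (n : ℝ) - ((X * Xᴴ) * spanProj (X + E)).trace.re ≤ r ^ 2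
  set P := spanProj (X + E)
  have h1 := (frobenius_norm_projection_mul_le hP hP2 X).1
  have h2 := (frobenius_norm_projection_mul_le hP hP2 E).2
  -- `1 - P` kills `X + E`, and the squared distance to bound is `‖(1 - P) X‖²`.
  have h3 : X - P * X = -(E - P * E) := by
    rw [Matrix.mul_add] at hA
    have : P * X = X + E - P * E := by rw [← hA]; abel
    rw [this]; abel
  rw [h3, norm_neg, frobenius_norm_sq_eq_trace X, hX] at h1
  rw [frobenius_norm_sq_eq_sum E] at h2
  have h4 : ((X * Xᴴ) * P).trace = (Xᴴ * P * X).trace := by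
    rw [Matrix.mul_assoc, Matrix.trace_mul_comm]
  rw [h4]
  have h5 : (1 : Matrix (Fin n) (Fin n) ℂ).trace.re = n := by simp
  linarith

/-- The distance of two noisy symbols is at least that of the clean symbols, up to the sizes of
the perturbations. -/
theorem procrustesDist_spanBasis_ge {X Y : Matrix (Fin T) (Fin n) ℂ} (hX : Xᴴ * X = 1)
    (hY : Yᴴ * Y = 1) (E F : Matrix (Fin T) (Fin n) ℂ) {r : ℝ} (hr : 0 ≤ r)
    (hE : ∑ i, ∑ j, ‖E i j‖ ^ 2 ≤ r ^ 2) (hF : ∑ i, ∑ j, ‖F i j‖ ^ 2 ≤ r ^ 2) :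
    procrustesDist X Y - 2 * r ≤ procrustesDist (spanBasis (X + E)) (spanBasis (Y + F)) := by
  have hs : 0 < Real.sqrt 2 := by positivity
  have h1 := norm_sub_le_procrustesDist (mul_self_of_orthonormal hX) (spanProj_mul_self (X + E))
    (trace_re_of_orthonormal hX).le (spanProj_trace_le _)
  have h2 := norm_sub_le_procrustesDist (spanProj_mul_self (X + E)) (spanProj_mul_self (Y + F))
    (spanProj_trace_le _) (spanProj_trace_le _)
  have h3 := norm_sub_le_procrustesDist (spanProj_mul_self (Y + F)) (mul_self_of_orthonormal hY)
    (spanProj_trace_le _) (trace_re_of_orthonormal hY).le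
  rw [procrustesDist_comm _ Y] at h3
  have h4 := procrustesDist_eq_norm_sub hX hY
  have h5 := procrustesDist_spanBasis_le hX E hr hE
  have h6 := procrustesDist_spanBasis_le hY F hr hF
  have h7 := norm_sub_le_norm_sub_add_norm_sub (X * Xᴴ)
    (spanBasis (X + E) * (spanBasis (X + E))ᴴ) (Y * Yᴴ)
  have h8 := norm_sub_le_norm_sub_add_norm_sub (spanBasis (X + E) * (spanBasis (X + E))ᴴ)
    (spanBasis (Y + F) * (spanBasis (Y + F))ᴴ) (Y * Yᴴ)
  nlinarith

theorem minDist_le {L : ℕ} (μ : Fin L → Matrix (Fin T) (Fin n) ℂ) {l m : Fin L} (h : l ≠ m) :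
    minDist μ ≤ procrustesDist (μ l) (μ m) :=
  ciInf_le (f := fun p : {p : Fin L × Fin L // p.1 ≠ p.2} => procrustesDist (μ p.1.1) (μ p.1.2))
    ⟨0, by rintro _ ⟨p, rfl⟩; exact Real.sqrt_nonneg _⟩ ⟨(l, m), h⟩

/-- All square unitary matrices span the same space. -/
theorem procrustesDist_square {X Y : Matrix (Fin n) (Fin n) ℂ} (hX : Xᴴ * X = 1)
    (hY : Yᴴ * Y = 1) : procrustesDist X Y = 0 := by
  rw [procrustesDist_eq, mul_eq_one_comm.mp hX, mul_eq_one_comm.mp hY]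
  simp

end Procrustes

end GrassmannDFS

/-! ### The Gamma tail and the asymptotic expansion -/

namespace GrassmannDFS

/-- The upper tail `e⁻ˣ ∑_{m < k} xᵐ / m!` of the Gamma law of shape `k`. -/
noncomputable def gammaTail (k : ℕ) (x : ℝ) : ℝ := Real.exp (-x) * ∑ m ∈ Finset.range k, x ^ m / m !

theorem gammaTail_nonneg (k : ℕ) {x : ℝ} (hx : 0 ≤ x) : 0 ≤ gammaTail k x := by
  unfold gammaTail; positivity

theorem gammaTail_le_one (k : ℕ) {x : ℝ} (hx : 0 ≤ x) : gammaTail k x ≤ 1 := by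
  have h := Real.sum_le_exp_of_nonneg hx k
  calc gammaTail k x ≤ Real.exp (-x) * Real.exp x := by unfold gammaTail; gcongr
    _ = 1 := by rw [← Real.exp_add]; simp

theorem exp_neg_le_gammaTail {k : ℕ} (hk : 1 ≤ k) {x : ℝ} (hx : 0 ≤ x) :
    Real.exp (-x) ≤ gammaTail k x := by
  have h : (1 : ℝ) ≤ ∑ m ∈ Finset.range k, x ^ m / m ! := by
    have := Finset.single_le_sum (f := fun m => x ^ m / (m ! : ℝ)) (s := Finset.range k)
      (fun i _ => by positivity) (Finset.mem_range.mpr hk)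
    simpa using this
  unfold gammaTail
  nlinarith [Real.exp_pos (-x)]

/-- The derivative telescopes, leaving minus the Gamma density of shape `k + 1`. -/
theorem hasDerivAt_gammaTail (k : ℕ) (x : ℝ) :
    HasDerivAt (gammaTail (k + 1)) (-(x ^ k * Real.exp (-x) / k !)) x := by
  induction k with
  | zero =>
    have h : gammaTail (0 + 1) = fun x => Real.exp (-x) := by
      funext y; simp [gammaTail]
    rw [h]
    simpa using (hasDerivAt_neg x).exp
  | succ k ih =>
    have h : gammaTail (k + 1 + 1) =
        fun y => gammaTail (k + 1) y + Real.exp (-y) * (y ^ (k + 1) / (k + 1)!) := by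
      funext y; rw [gammaTail, Finset.sum_range_succ, mul_add]; rfl
    rw [h]
    refine (ih.add ((hasDerivAt_neg x).exp.mul
      ((hasDerivAt_pow (k + 1) x).div_const _))).congr_deriv ?_
    have : (k ! : ℝ) ≠ 0 := by positivity
    rw [Nat.factorial_succ]
    push_cast
    field_simp
    ring

theorem lowerGamma_nat {k : ℕ} (hk : 1 ≤ k) (x : ℝ) :
    1 / Real.Gamma k * lowerGamma k x = 1 - gammaTail k x := by
  obtain ⟨k, rfl⟩ := Nat.exists_eq_add_of_le' hk
  have hf : (k ! : ℝ) ≠ 0 := by positivity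
  have hcont : Continuous fun t : ℝ => -(t ^ k * Real.exp (-t) / k !) := by fun_prop
  have h := intervalIntegral.integral_eq_sub_of_hasDerivAt
    (fun t _ => hasDerivAt_gammaTail k t) (hcont.intervalIntegrable 0 x)
  have h0 : gammaTail (k + 1) 0 = 1 := by
    simp [gammaTail, Finset.sum_range_succ']
  rw [intervalIntegral.integral_neg, intervalIntegral.integral_div, h0] at h
  have h2 : lowerGamma ((k + 1 : ℕ) : ℝ) x = ∫ t in (0 : ℝ)..x, t ^ k * Real.exp (-t) := by
    simp [lowerGamma]
  rw [h2, Nat.cast_succ, Real.Gamma_nat_eq_factorial, one_div, inv_mul_eq_div]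
  linarith

/-- The second order Bernoulli estimate. -/
theorem abs_one_sub_pow_sub_le {e : ℝ} (h0 : 0 ≤ e) (h1 : e ≤ 1) (N : ℕ) :
    |(1 - e) ^ N - (1 - N * e)| ≤ N ^ 2 * e ^ 2 := by
  have key : 1 - N * e ≤ (1 - e) ^ N ∧ (1 - e) ^ N ≤ 1 - N * e + N ^ 2 * e ^ 2 := by
    induction N with
    | zero => simp
    | succ N ih =>
      obtain ⟨ha, hb⟩ := ih
      have hN : (0 : ℝ) ≤ N := Nat.cast_nonneg N
      rw [pow_succ]
      push_cast
      have h2 : 0 ≤ (N : ℝ) * e ^ 2 := by positivity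
      have h3 : 0 ≤ (N : ℝ) ^ 2 * e ^ 3 := by positivity
      constructor
      · nlinarith [mul_le_mul_of_nonneg_right ha (sub_nonneg.mpr h1)]
      · nlinarith [mul_le_mul_of_nonneg_right hb (sub_nonneg.mpr h1), sq_nonneg e]
  rw [abs_of_nonneg (by linarith [key.1])]
  linarith [key.2]

theorem exp_mul_polyC (T Nt : ℕ) (lam δ ρ : ℝ) :
    Real.exp (-(ρ * T * lam ^ 2 * δ ^ 2 / (8 * Nt))) * polyC T Nt lam δ ρ =
      gammaTail (grassDim T Nt / 2) (rate T Nt lam δ * ρ) := by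
  have h : ρ * T * lam ^ 2 * δ ^ 2 / (8 * Nt) = rate T Nt lam δ * ρ := by
    rw [rate]; ring
  rw [h, gammaTail, polyC]
  congr 1
  refine Finset.sum_congr rfl fun m _ => ?_
  rw [rate, mul_pow _ ρ, div_pow]
  simp only [div_eq_mul_inv, mul_inv]
  ring

theorem sepBound_eq {T Nt : ℕ} (hNt : 1 ≤ Nt) (hT : Nt < T) (N : ℕ) (lam δ ρ : ℝ) :
    sepBound T Nt N lam δ ρ =
      (1 - gammaTail (grassDim T Nt / 2) (rate T Nt lam δ * ρ)) ^ N := by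
  have hd : grassDim T Nt / 2 = Nt * (T - Nt) := by
    rw [grassDim, mul_assoc, Nat.mul_div_cancel_left _ two_pos]
  have hk : 1 ≤ Nt * (T - Nt) := Nat.mul_pos hNt (Nat.sub_pos_of_lt hT)
  have hc : (grassDim T Nt : ℝ) / 2 = (Nt * (T - Nt) : ℕ) := by
    rw [grassDim, mul_assoc]; push_cast; ring
  have h : ρ * T * lam ^ 2 * δ ^ 2 / (8 * Nt) = rate T Nt lam δ * ρ := by
    rw [rate]; ring
  rw [sepBound, hc, h, lowerGamma_nat hk, hd]

theorem rate_nonneg (T Nt : ℕ) (lam δ : ℝ) : 0 ≤ rate T Nt lam δ := by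
  unfold rate; positivity

theorem isBigO_remainder {T Nt : ℕ} (hNt : 1 ≤ Nt) (hT : Nt < T) (N : ℕ) (lam δ : ℝ) :
    (fun ρ => sepBound T Nt N lam δ ρ - (1 - N * Real.exp (-(ρ * T * lam ^ 2 * δ ^ 2 / (8 * Nt)))
          * polyC T Nt lam δ ρ)) =O[atTop]
      fun ρ => Real.exp (-(2 * rate T Nt lam δ * ρ)) * polyC T Nt lam δ ρ ^ 2 := by
  refine IsBigO.of_bound ((N : ℝ) ^ 2) ?_
  filter_upwards [eventually_ge_atTop 0] with ρ hρ
  have hx : 0 ≤ rate T Nt lam δ * ρ := mul_nonneg (rate_nonneg ..) hρ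
  have e1 : Real.exp (-(2 * rate T Nt lam δ * ρ)) * polyC T Nt lam δ ρ ^ 2 =
      gammaTail (grassDim T Nt / 2) (rate T Nt lam δ * ρ) ^ 2 := by
    rw [← exp_mul_polyC, mul_pow, ← Real.exp_nat_mul]
    congr 2
    rw [rate]; push_cast; ring
  rw [e1, mul_assoc (N : ℝ), exp_mul_polyC, sepBound_eq hNt hT, Real.norm_eq_abs,
    Real.norm_of_nonneg (sq_nonneg _)]
  exact abs_one_sub_pow_sub_le (gammaTail_nonneg _ hx) (gammaTail_le_one _ hx) N

theorem isBigO_exp_mul_polyC_sq {T Nt : ℕ} {lam δ : ℝ} (hc : 1 < rate T Nt lam δ) :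
    (fun ρ => Real.exp (-(2 * rate T Nt lam δ * ρ)) * polyC T Nt lam δ ρ ^ 2) =O[atTop]
      fun ρ => Real.exp (-(2 * ρ)) := by
  set c := rate T Nt lam δ
  -- The excess `c - 1 > 0` in the exponent absorbs the polynomial.
  have h1 : (fun ρ => polyC T Nt lam δ ρ) =O[atTop] fun ρ => Real.exp ((c - 1) * ρ) := by
    unfold polyC
    refine IsBigO.fun_sum fun m _ =>
      (isLittleO_pow_exp_pos_mul_atTop m (sub_pos.mpr hc)).isBigO.const_mul_left _
  refine ((isBigO_refl (fun ρ => Real.exp (-(2 * c * ρ))) atTop).mul (h1.pow 2)).congr_right ?_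
  intro ρ
  rw [← Real.exp_nat_mul, ← Real.exp_add]
  congr 1; push_cast; ring

end GrassmannDFS

/-! ### Gaussian concentration and the probability bound -/

namespace GrassmannDFS

instance : IsProbabilityMeasure complexGaussian :=
  Measure.isProbabilityMeasure_map (MeasurableEquiv.measurable _).aemeasurable

instance (m n : ℕ) : IsProbabilityMeasure (gaussianArray m n) := by
  unfold gaussianArray; infer_instance

theorem integrable_exp_sq_gaussianReal :
    Integrable (fun x : ℝ => Real.exp (3 / 4 * x ^ 2)) (gaussianReal 0 (1 / 2)) := by
  have hv : (1 / 2 : NNReal) ≠ 0 := by norm_num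
  rw [gaussianReal_of_var_ne_zero _ hv,
    integrable_withDensity_iff_integrable_smul' (measurable_gaussianPDF _ _)
      (ae_of_all _ fun _ => gaussianPDF_lt_top)]
  simp only [toReal_gaussianPDF, smul_eq_mul, gaussianPDFReal]
  -- Variance `1 / 2` gives density `∝ exp (-x²)`, so any factor below `1` works; `3 / 4` leaves
  -- `exp (-x² / 4)`.
  refine ((integrable_exp_neg_mul_sq (b := 1 / 4) (by norm_num)).const_mul
    ((Real.sqrt (2 * Real.pi * ((1 / 2 : NNReal) : ℝ)))⁻¹)).congr (ae_of_all _ fun x => ?_)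
  simp only []
  rw [mul_assoc (Real.sqrt _)⁻¹, ← Real.exp_add]
  congr 2
  push_cast
  ring

theorem integrable_exp_sq_complexGaussian :
    Integrable (fun z : ℂ => Real.exp (3 / 4 * ‖z‖ ^ 2)) complexGaussian := by
  unfold complexGaussian
  rw [integrable_map_equiv]
  refine (integrable_exp_sq_gaussianReal.mul_prod integrable_exp_sq_gaussianReal).congr
    (ae_of_all _ fun p => ?_)
  simp only [Function.comp_apply]
  rw [← Real.exp_add, ← Complex.normSq_eq_norm_sq, Complex.normSq_apply]
  congr 1
  simp [Complex.measurableEquivRealProd]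
  ring

theorem integrable_exp_sq_gaussianArray (m n : ℕ) :
    Integrable (fun W : Fin m → Fin n → ℂ => Real.exp (3 / 4 * ∑ i, ∑ j, ‖W i j‖ ^ 2))
      (gaussianArray m n) := by
  have hrow : Integrable (fun w : Fin n → ℂ => ∏ j, Real.exp (3 / 4 * ‖w j‖ ^ 2))
      (Measure.pi fun _ => complexGaussian) :=
    Integrable.fintype_prod (f := fun _ (z : ℂ) => Real.exp (3 / 4 * ‖z‖ ^ 2)) fun _ =>
      integrable_exp_sq_complexGaussian
  have h : Integrable (fun W : Fin m → Fin n → ℂ => ∏ i, ∏ j, Real.exp (3 / 4 * ‖W i j‖ ^ 2))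
      (gaussianArray m n) :=
    Integrable.fintype_prod
      (f := fun _ (w : Fin n → ℂ) => ∏ j, Real.exp (3 / 4 * ‖w j‖ ^ 2)) fun _ => hrow
  simpa only [← Real.exp_sum, ← Finset.mul_sum] using h

/-- The Chernoff bound for the squared Frobenius norm of a Gaussian matrix. -/
theorem gaussianArray_ball_ge (m n : ℕ) : ∃ K : ℝ, ∀ a : ℝ,
    1 - K * Real.exp (-(3 / 4) * a) ≤
      (gaussianArray m n).real {W | ∑ i, ∑ j, ‖W i j‖ ^ 2 < a} := by
  refine ⟨mgf (fun W : Fin m → Fin n → ℂ => ∑ i, ∑ j, ‖W i j‖ ^ 2) (gaussianArray m n) (3 / 4),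
    fun a => ?_⟩
  have h1 := measure_ge_le_exp_mul_mgf a (by norm_num) (integrable_exp_sq_gaussianArray m n)
  have h2 := measureReal_union_le (μ := gaussianArray m n)
    {W | ∑ i, ∑ j, ‖W i j‖ ^ 2 < a} {W | a ≤ ∑ i, ∑ j, ‖W i j‖ ^ 2}
  have h3 : {W : Fin m → Fin n → ℂ | ∑ i, ∑ j, ‖W i j‖ ^ 2 < a} ∪
      {W | a ≤ ∑ i, ∑ j, ‖W i j‖ ^ 2} = Set.univ := by
    ext W; simp [lt_or_ge]
  rw [h3, probReal_univ] at h2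
  linarith

/-- If every noise matrix in `S` perturbs the codewords by at most `r`, with `2 r` smaller than
the gap between the minimum distance and the threshold, then the symbols are separated as soon as
all noise matrices lie in `S`. -/
theorem pow_le_sepProb {T Nt L N : ℕ} {μ : Fin L → Matrix (Fin T) (Fin Nt) ℂ}
    (hμ : ∀ l, (μ l)ᴴ * μ l = 1) (Q : Measure (Fin N → Fin L)) [IsProbabilityMeasure Q]
    {lam ρ γ₀ r : ℝ} (hr : 0 ≤ r) (hγ : 2 * r < minDist μ - γ₀)
    {S : Set (Fin T → Fin Nt → ℂ)}
    (hS : ∀ W ∈ S, (1 / lam * Real.sqrt (Nt / (ρ * T))) ^ 2 * ∑ i, ∑ j, ‖W i j‖ ^ 2 ≤ r ^ 2) :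
    (gaussianArray T Nt).real S ^ N ≤ sepProb μ Q lam ρ γ₀ := by
  have hE : (Q.prod (Measure.pi fun _ : Fin N => gaussianArray T Nt)).real
      (Set.univ ×ˢ Set.univ.pi fun _ => S) = (gaussianArray T Nt).real S ^ N := by
    simp [Measure.real, Measure.prod_prod, Measure.pi_pi]
  rw [← hE]
  -- Monotonicity needs no measurability of the separation event.
  refine measureReal_mono ?_
  rintro ⟨s, W⟩ ⟨-, hW⟩
  have hn : ∀ i, ∑ a, ∑ b, ‖(((1 / lam * Real.sqrt (Nt / (ρ * T)) : ℝ) : ℂ) •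
      (Matrix.of (W i) : Matrix (Fin T) (Fin Nt) ℂ)) a b‖ ^ 2 ≤ r ^ 2 := by
    intro i
    refine le_of_eq_of_le ?_ (hS (W i) (hW i (Set.mem_univ i)))
    simp only [Matrix.smul_apply, smul_eq_mul, norm_mul, mul_pow, Complex.norm_real,
      Real.norm_eq_abs, sq_abs, Finset.mul_sum, Matrix.of_apply]
  refine lt_of_lt_of_le (b := ((minDist μ - 2 * r : ℝ) : EReal))
    (EReal.coe_lt_coe_iff.mpr (by linarith)) ?_
  refine le_iInf fun m => le_iInf fun l => le_iInf fun hml => le_iInf fun i => le_iInf fun hi =>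
    le_iInf fun j => le_iInf fun hj => ?_
  have hi' : s i = m := hi
  have hj' : s j = l := hj
  have hd := minDist_le μ (l := s i) (m := s j) (by rw [hi', hj']; exact hml)
  have := procrustesDist_spanBasis_ge (hμ (s i)) (hμ (s j)) _ _ hr (hn i) (hn j)
  exact EReal.coe_le_coe_iff.mpr (le_trans (by linarith) this)

theorem eventually_sepBound_le_sepProb {T Nt L N : ℕ} (hNt : 1 ≤ Nt) (hT : Nt < T)
    {μ : Fin L → Matrix (Fin T) (Fin Nt) ℂ} (hμ : ∀ l, (μ l)ᴴ * μ l = 1) {γ₀ : ℝ}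
    (hγ : γ₀ < minDist μ) (Q : Measure (Fin N → Fin L)) [IsProbabilityMeasure Q] (lam : ℝ) :
    ∀ᶠ ρ : ℝ in atTop,
      sepBound T Nt N lam (minDist μ - γ₀) ρ ≤ sepProb μ Q lam ρ γ₀ := by
  set δ := minDist μ - γ₀ with hδ
  have hδ0 : 0 < δ := sub_pos.mpr hγ
  have hk : 1 ≤ grassDim T Nt / 2 := by
    rw [grassDim, mul_assoc, Nat.mul_div_cancel_left _ two_pos]
    exact Nat.mul_pos hNt (Nat.sub_pos_of_lt hT)
  have hT0 : (0 : ℝ) < T := by exact_mod_cast (Nat.zero_le _).trans_lt hT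
  have hNt0 : (0 : ℝ) < Nt := by exact_mod_cast hNt
  -- With `1 / 0 = 0` the noise disappears and separation is certain; positivity of the mean
  -- singular value is thus not needed.
  by_cases hlam : lam = 0
  · filter_upwards [eventually_ge_atTop 0] with ρ hρ
    have hx : 0 ≤ rate T Nt lam δ * ρ := mul_nonneg (rate_nonneg ..) hρ
    have h := pow_le_sepProb hμ Q (lam := lam) (ρ := ρ) (γ₀ := γ₀) le_rfl
      (by linarith : 2 * (0 : ℝ) < minDist μ - γ₀) (S := Set.univ) (by simp [hlam])
    rw [probReal_univ, one_pow] at h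
    rw [sepBound_eq hNt hT]
    exact (pow_le_one₀ (sub_nonneg.mpr (gammaTail_le_one _ hx))
      (sub_le_self _ (gammaTail_nonneg _ hx))).trans h
  have hc : 0 < rate T Nt lam δ := by unfold rate; positivity
  obtain ⟨K, hK⟩ := gaussianArray_ball_ge T Nt
  have hlim : Tendsto (fun ρ => K * Real.exp (-(1 / 5 * rate T Nt lam δ * ρ))) atTop
      (nhds (K * 0)) :=
    (Real.tendsto_exp_neg_atTop_nhds_zero.comp
      (tendsto_id.const_mul_atTop (by positivity))).const_mul K
  rw [mul_zero] at hlim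
  filter_upwards [eventually_gt_atTop 0, hlim.eventually_le_const zero_lt_one] with ρ hρ hle
  have hx : 0 ≤ rate T Nt lam δ * ρ := mul_nonneg hc.le hρ.le
  -- Squared radius `8/5 cρ` gives the Chernoff exponent `3/4 · 8/5 = 6/5 > 1`; the spare `1/5`
  -- beats `K`.
  have htail : K * Real.exp (-(3 / 4) * (8 / 5 * (rate T Nt lam δ * ρ))) ≤
      gammaTail (grassDim T Nt / 2) (rate T Nt lam δ * ρ) := by
    refine le_trans ?_ (exp_neg_le_gammaTail hk hx)
    have : -(3 / 4) * (8 / 5 * (rate T Nt lam δ * ρ)) =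
      -(1 / 5 * rate T Nt lam δ * ρ) + -(rate T Nt lam δ * ρ) := by ring
    rw [this, Real.exp_add, ← mul_assoc]
    exact mul_le_of_le_one_left (Real.exp_pos _).le hle
  rw [sepBound_eq hNt hT]
  -- This radius scales to noise of squared norm below `δ² / 5 ≤ (9/20 δ)²`, while `2 · 9/20 < 1`.
  refine le_trans (pow_le_pow_left₀ (sub_nonneg.mpr (gammaTail_le_one _ hx))
    ((sub_le_sub_left htail 1).trans (hK _)) N)
    (pow_le_sepProb hμ Q (r := 9 / 20 * δ) (by positivity) (by linarith) fun W hW => ?_)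
  have hσ : (1 / lam * Real.sqrt (Nt / (ρ * T))) ^ 2 = Nt / (lam ^ 2 * (ρ * T)) := by
    rw [mul_pow, Real.sq_sqrt (by positivity)]
    field_simp
  rw [hσ]
  calc (Nt : ℝ) / (lam ^ 2 * (ρ * T)) * ∑ i, ∑ j, ‖W i j‖ ^ 2
      ≤ Nt / (lam ^ 2 * (ρ * T)) * (8 / 5 * (rate T Nt lam δ * ρ)) := by
        have : ∑ i, ∑ j, ‖W i j‖ ^ 2 < 8 / 5 * (rate T Nt lam δ * ρ) := hW
        gcongr
    _ = 1 / 5 * δ ^ 2 := by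
        rw [rate]; field_simp
    _ ≤ (9 / 20 * δ) ^ 2 := by nlinarith [sq_nonneg δ]

end GrassmannDFS

theorem corollary1 (T Nt Nr L N : ℕ) (hNt : 1 ≤ Nt) (hT : Nt ≤ T) (hNr : Nt ≤ Nr) (hL : 2 ≤ L)
    (μ : Fin L → Matrix (Fin T) (Fin Nt) ℂ) (hμ : ∀ l, (μ l)ᴴ * μ l = 1)
    (γ₀ : ℝ) (hγ₀ : 0 ≤ γ₀) (hγ : γ₀ < GrassmannDFS.minDist μ)
    (Q : Measure (Fin N → Fin L)) [IsProbabilityMeasure Q] :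
    let lam : ℝ := GrassmannDFS.meanSingularValue Nt Nr
    let δ : ℝ := GrassmannDFS.minDist μ - γ₀
    let c : ℝ := GrassmannDFS.rate T Nt lam δ
    let R : ℝ → ℝ := fun ρ => GrassmannDFS.sepBound T Nt N lam δ ρ
      - (1 - N * Real.exp (-(ρ * T * lam ^ 2 * δ ^ 2 / (8 * Nt)))
          * GrassmannDFS.polyC T Nt lam δ ρ)
    (∀ᶠ ρ : ℝ in atTop,
      GrassmannDFS.sepBound T Nt N lam δ ρ ≤ GrassmannDFS.sepProb μ Q lam ρ γ₀) ∧
    (R =O[atTop] fun ρ : ℝ =>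
      Real.exp (-(2 * c * ρ)) * GrassmannDFS.polyC T Nt lam δ ρ ^ 2) ∧
    (1 < c → R =O[atTop] fun ρ : ℝ => Real.exp (-(2 * ρ))) := by
  -- If `Nt = T`, all codewords span the whole space and `minDist μ ≤ 0 ≤ γ₀`.
  have hT' : Nt < T := by
    refine lt_of_le_of_ne hT fun h => ?_
    subst h
    have hne : (⟨0, by omega⟩ : Fin L) ≠ ⟨1, by omega⟩ := by simp
    have h1 := GrassmannDFS.minDist_le μ hne
    rw [GrassmannDFS.procrustesDist_square (hμ _) (hμ _)] at h1
    linarith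
  intro lam δ c R
  have hR := GrassmannDFS.isBigO_remainder hNt hT' N lam δ
  exact ⟨GrassmannDFS.eventually_sepBound_le_sepProb hNt hT' hμ hγ Q lam, hR,
    fun hc => hR.trans (GrassmannDFS.isBigO_exp_mul_polyC_sq hc)⟩
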